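/- Let $\mathsf{Topoi}$ be the 2-category of Grothendieck topoi, geometric morphisms $f=(f^*\dashv f_*)$ (with $f^*$ preserving finite limits), and natural transformations $f^*\Rightarrow g^*$ between inverse images as 2-cells $f\Rightarrow g$. A geometric morphism $f:\mathcal E\to\mathcal F$ is *hyperconnected* if $f^*$ is fully faithful and its essential image is closed under subobjects in $\mathcal E$; let $\mathcal H_{\mathrm{hy}}$ be the class of hyperconnected geometric morphisms. A topos is *localic* if it is equivalent to the topos of sheaves on a (small) locale. Let $\mathcal H$ be a class of 1-cells of a 2-category $\mathcal K$. An object $X$ is *right Kan injective* with respect to $\mathcal H$ if for every $f:A\to B$ in $\mathcal H$ and every $x:A\to X$ the right Kan extension $(\mathsf{ran}_f x,\ \epsilon:\mathsf{ran}_f x\circ f\Rightarrow x)$ exists in $\mathcal K$ and $\epsilon$ is invertible. Dually, $X$ is *left Kan injective* if every left Kan extension $(\mathsf{lan}_f x,\ \eta: x\Rightarrow \mathsf{lan}_f x\circ f)$ exists and $\eta$ is invertible. Let $\mathsf{RInj}(\mathcal H)$ (resp. $\mathsf{LInj}(\mathcal H)$) be the locally full sub-2-category of $\mathcal K$ whose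 objects are the right (resp. left) Kan injective ones and whose 1-cells are the 1-cells $h:X\to Y$ between such objects that preserve these Kan extensions, i.e. for all $f:A\to B$ in $\mathcal H$ and $x:A\to X$, the 1-cell $h\circ\mathsf{ran}_fx$ with the 2-cell $h\epsilon$ is a right Kan extension of $hx$ along $f$ (resp. the dual condition). Then: 1. A topos $\mathcal L$ is localic if and only if it is right Kan injective in $\mathsf{Topoi}$ with respect to all hyperconnected geometric morphisms. 2. Let $\mathsf{LocTopoi}$ be the full sub-2-category of $\mathsf{Topoi}$ on the localic topoi. Then $$\mathsf{LInj}(\mathcal H_{\mathrm{hy}})=\mathsf{RInj}(\mathcal H_{\mathrm{hy}})=\mathsf{LocTopoi}$$ as sub-2-categories of $\mathsf{Topoi}$: they have the same objects and the same 1-cells (and all 2-cells between these). In particular, every geometric morphism between localic topoi preserves the left and right Kan extensions in question. -/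

import Mathlib

open CategoryTheory Bicategory

universe w v u

/-! ### Kan injectivity in a bicategory -/

namespace KanInj

section Bicat

variable {B : Type u} [Bicategory.{w, v} B]

/-- A class of 1-cells of a bicategory. -/
abbrev OneCellClass (B : Type u) [Bicategory.{w, v} B] := ∀ ⦃X Y : B⦄, (X ⟶ Y) → Prop

/-- Whiskering the counit of a right extension with a 1-cell `h`. -/
def rightWhisker {a b c d : B} {f : a ⟶ b} {x : a ⟶ c} (t : RightExtension f x) (h : c ⟶ d) :
    RightExtension f (x ≫ h) :=
  RightExtension.mk (t.extension ≫ h) ((α_ f t.extension h).inv ≫ t.counit ▷ h)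

/-- `X` is right Kan injective with respect to `H`: for every `f : a ⟶ b` in `H`, every
`x : a ⟶ X` has a right Kan extension along `f`, with invertible counit. -/
def IsRightKanInjective (H : OneCellClass B) (X : B) : Prop :=
  ∀ ⦃a b : B⦄ (f : a ⟶ b), H f → ∀ x : a ⟶ X,
    ∃ t : RightExtension f x, Nonempty t.IsKan ∧ IsIso t.counit

/-- `X` is left Kan injective with respect to `H`: for every `f : a ⟶ b` in `H`, every
`x : a ⟶ X` has a left Kan extension along `f`, with invertible unit. -/
def IsLeftKanInjective (H : OneCellClass B) (X : B) : Prop :=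
  ∀ ⦃a b : B⦄ (f : a ⟶ b), H f → ∀ x : a ⟶ X,
    ∃ t : LeftExtension f x, Nonempty t.IsKan ∧ IsIso t.unit

/-- `h` preserves all right Kan extensions of 1-cells into its source along members of `H`. -/
def PreservesRightKan (H : OneCellClass B) {X Y : B} (h : X ⟶ Y) : Prop :=
  ∀ ⦃a b : B⦄ (f : a ⟶ b), H f → ∀ (x : a ⟶ X) (t : RightExtension f x),
    Nonempty t.IsKan → Nonempty (rightWhisker t h).IsKan

/-- `h` preserves all left Kan extensions of 1-cells into its source along members of `H`. -/
def PreservesLeftKan (H : OneCellClass B) {X Y : B} (h : X ⟶ Y) : Prop :=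
  ∀ ⦃a b : B⦄ (f : a ⟶ b), H f → ∀ (x : a ⟶ X) (t : LeftExtension f x),
    Nonempty t.IsKan → Nonempty (t.whisker h).IsKan

theorem rightKan_iff {a b c : B} {f : a ⟶ b} {x : a ⟶ c} (t : RightExtension f x) :
    Nonempty t.IsKan ↔ ∀ y : b ⟶ c,
      Function.Bijective (fun β : y ⟶ t.extension => f ◁ β ≫ t.counit) := by
  constructor
  · rintro ⟨H⟩ y
    constructor
    · intro β γ e
      exact CostructuredArrow.IsUniversal.hom_ext H e
    · intro σ
      exact ⟨CostructuredArrow.IsUniversal.lift H (RightExtension.mk y σ),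
        CostructuredArrow.IsUniversal.fac H (RightExtension.mk y σ)⟩
  · intro h
    choose l hl using fun s : RightExtension f x => (h (RightExtension.extension s)).2 s.counit
    exact ⟨Limits.IsTerminal.ofUniqueHom (fun s => RightExtension.homMk (t := t) (l s) (hl s))
      (fun s m => CostructuredArrow.hom_ext _ _
        ((h (RightExtension.extension s)).1 ((RightExtension.w m).trans (hl s).symm)))⟩

theorem leftKan_iff {a b c : B} {f : a ⟶ b} {x : a ⟶ c} (t : LeftExtension f x) :
    Nonempty t.IsKan ↔ ∀ y : b ⟶ c,
      Function.Bijective (fun β : t.extension ⟶ y => t.unit ≫ f ◁ β) := by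
  constructor
  · rintro ⟨H⟩ y
    exact ⟨fun β γ e => H.hom_ext e, fun σ => ⟨H.desc (LeftExtension.mk y σ), H.fac _⟩⟩
  · intro h
    choose l hl using fun s : LeftExtension f x => (h (LeftExtension.extension s)).2 s.unit
    exact ⟨LeftExtension.IsKan.mk (fun s => LeftExtension.homMk (l s) (hl s))
      (fun s m => StructuredArrow.hom_ext _ _
        ((h (LeftExtension.extension s)).1 ((LeftExtension.w m).trans (hl s).symm)))⟩

/-- Right Kan extensions may be transported along invertible 2-cells. -/
theorem rightKan_transport {a b c : B} {f : a ⟶ b} {x x' : a ⟶ c} {r r' : b ⟶ c}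
    (i : r' ≅ r) (j : x ≅ x') (ρ : f ≫ r ⟶ x) (δ : f ≫ r' ⟶ x')
    (e : δ = f ◁ i.hom ≫ ρ ≫ j.hom) (h : Nonempty (RightExtension.mk r ρ).IsKan) :
    Nonempty (RightExtension.mk r' δ).IsKan := by
  rw [rightKan_iff] at h ⊢
  intro y
  subst e
  have h1 : Function.Bijective (fun β : y ⟶ r' => β ≫ i.hom) :=
    ⟨fun β γ e => (cancel_mono i.hom).1 e, fun β => ⟨β ≫ i.inv, by simp⟩⟩
  have h2 : Function.Bijective (fun β : f ≫ y ⟶ x => β ≫ j.hom) :=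
    ⟨fun β γ e => (cancel_mono j.hom).1 e, fun β => ⟨β ≫ j.inv, by simp⟩⟩
  have h3 : Function.Bijective ((fun β => β ≫ j.hom) ∘ (fun β : y ⟶ r => f ◁ β ≫ ρ) ∘
      fun β => β ≫ i.hom) := h2.comp ((h y).comp h1)
  have h4 : (fun β : y ⟶ r' => f ◁ β ≫ f ◁ i.hom ≫ ρ ≫ j.hom) =
      (fun β => β ≫ j.hom) ∘ (fun β : y ⟶ r => f ◁ β ≫ ρ) ∘ fun β => β ≫ i.hom :=
    funext fun β => by simp
  exact h4 ▸ h3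

/-- Left Kan extensions may be transported along invertible 2-cells. -/
theorem leftKan_transport {a b c : B} {f : a ⟶ b} {x x' : a ⟶ c} {r r' : b ⟶ c}
    (i : r ≅ r') (j : x' ≅ x) (η : x ⟶ f ≫ r) (θ : x' ⟶ f ≫ r')
    (e : θ = j.hom ≫ η ≫ f ◁ i.hom) (h : Nonempty (LeftExtension.mk r η).IsKan) :
    Nonempty (LeftExtension.mk r' θ).IsKan := by
  rw [leftKan_iff] at h ⊢
  intro y
  subst e
  have h1 : Function.Bijective (fun β : r' ⟶ y => i.hom ≫ β) :=
    ⟨fun β γ e => (cancel_epi i.hom).1 e, fun β => ⟨i.inv ≫ β, by simp⟩⟩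
  have h2 : Function.Bijective (fun β : x ⟶ f ≫ y => j.hom ≫ β) :=
    ⟨fun β γ e => (cancel_epi j.hom).1 e, fun β => ⟨j.inv ≫ β, by simp⟩⟩
  have h3 : Function.Bijective ((fun β => j.hom ≫ β) ∘ (fun β : r ⟶ y => η ≫ f ◁ β) ∘
      fun β => i.hom ≫ β) := h2.comp ((h y).comp h1)
  have h4 : (fun β : r' ⟶ y => (j.hom ≫ η ≫ f ◁ i.hom) ≫ f ◁ β) =
      (fun β => j.hom ≫ β) ∘ (fun β : r ⟶ y => η ≫ f ◁ β) ∘ fun β => i.hom ≫ β :=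
    funext fun β => by simp
  exact h4 ▸ h3

theorem PreservesRightKan.id (H : OneCellClass B) (X : B) : PreservesRightKan H (𝟙 X) := by
  intro a b f _ x t ht
  exact rightKan_transport (ρ_ t.extension) (ρ_ x).symm t.counit _ (by simp) ht

theorem PreservesLeftKan.id (H : OneCellClass B) (X : B) : PreservesLeftKan H (𝟙 X) := by
  intro a b f _ x t ht
  exact leftKan_transport (ρ_ t.extension).symm (ρ_ x) t.unit _ (by simp) ht

theorem PreservesRightKan.comp {H : OneCellClass B} {X Y Z : B} {h : X ⟶ Y} {k : Y ⟶ Z}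
    (hh : PreservesRightKan H h) (hk : PreservesRightKan H k) : PreservesRightKan H (h ≫ k) := by
  intro a b f hf x t ht
  refine rightKan_transport (α_ t.extension h k).symm (α_ x h k)
    ((α_ f (t.extension ≫ h) k).inv ≫ ((α_ f t.extension h).inv ≫ t.counit ▷ h) ▷ k) _ ?_
    (hk f hf _ _ (hh f hf x t ht))
  simp

theorem PreservesLeftKan.comp {H : OneCellClass B} {X Y Z : B} {h : X ⟶ Y} {k : Y ⟶ Z}
    (hh : PreservesLeftKan H h) (hk : PreservesLeftKan H k) : PreservesLeftKan H (h ≫ k) := by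
  intro a b f hf x t ht
  exact leftKan_transport (α_ t.extension h k) (α_ x h k).symm _ _ (by simp)
    (hk f hf _ _ (hh f hf x t ht))

/-- A locally full sub-2-category: a class of objects and a class of 1-cells between them, closed
under identities and composition; it contains all 2-cells between its 1-cells. -/
@[ext]
structure LocallyFullSub (B : Type u) [Bicategory.{w, v} B] where
  obj : B → Prop
  hom : OneCellClass B
  obj_source : ∀ ⦃X Y : B⦄ (h : X ⟶ Y), hom h → obj X
  obj_target : ∀ ⦃X Y : B⦄ (h : X ⟶ Y), hom h → obj Y
  id_mem : ∀ X : B, obj X → hom (𝟙 X)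
  comp_mem : ∀ ⦃X Y Z : B⦄ (h : X ⟶ Y) (k : Y ⟶ Z), hom h → hom k → hom (h ≫ k)

/-- The full sub-2-category on a class of objects. -/
def fullSub (P : B → Prop) : LocallyFullSub B where
  obj := P
  hom X Y _ := P X ∧ P Y
  obj_source _ _ _ h := h.1
  obj_target _ _ _ h := h.2
  id_mem _ h := ⟨h, h⟩
  comp_mem _ _ _ _ _ h k := ⟨h.1, k.2⟩

/-- The right Kan injectivity class of `H`. -/
def RInj (H : OneCellClass B) : LocallyFullSub B where
  obj := IsRightKanInjective H
  hom X Y h := IsRightKanInjective H X ∧ IsRightKanInjective H Y ∧ PreservesRightKan H h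
  obj_source _ _ _ h := h.1
  obj_target _ _ _ h := h.2.1
  id_mem X h := ⟨h, h, PreservesRightKan.id H X⟩
  comp_mem _ _ _ _ _ h k := ⟨h.1, k.2.1, h.2.2.comp k.2.2⟩

/-- The left Kan injectivity class of `H`. -/
def LInj (H : OneCellClass B) : LocallyFullSub B where
  obj := IsLeftKanInjective H
  hom X Y h := IsLeftKanInjective H X ∧ IsLeftKanInjective H Y ∧ PreservesLeftKan H h
  obj_source _ _ _ h := h.1
  obj_target _ _ _ h := h.2.1
  id_mem X h := ⟨h, h, PreservesLeftKan.id H X⟩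
  comp_mem _ _ _ _ _ h k := ⟨h.1, k.2.1, h.2.2.comp k.2.2⟩

end Bicat

/-! ### The 2-category of Grothendieck topoi -/

/-- A Grothendieck topos: a category equivalent to the sheaves of sets on a small site. -/
def IsGrothendieckTopos (E : Type (w + 1)) [Category.{w} E] : Prop :=
  ∃ (C : Type w) (_ : SmallCategory C) (J : GrothendieckTopology C),
    Nonempty (E ≌ Sheaf J (Type w))

/-- A bundled Grothendieck topos. -/
structure Topos where
  carrier : Type (w + 1)
  [cat : Category.{w} carrier]
  isTopos : IsGrothendieckTopos carrier

attribute [instance] Topos.cat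

/-- A geometric morphism from `E` to `F`: an adjunction `inverse ⊣ direct` with `direct : E ⥤ F`
and `inverse` preserving finite limits. -/
structure GeomMorph (E F : Topos.{w}) where
  inverse : F.carrier ⥤ E.carrier
  direct : E.carrier ⥤ F.carrier
  adj : inverse ⊣ direct
  lex : Limits.PreservesFiniteLimits inverse

namespace GeomMorph

/-- The identity geometric morphism. -/
@[simps inverse direct]
def id (E : Topos.{w}) : GeomMorph E E where
  inverse := 𝟭 _
  direct := 𝟭 _
  adj := Adjunction.id
  lex := inferInstance

/-- The composite `E ⟶ F ⟶ G`. -/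
@[simps inverse direct]
def comp {E F G : Topos.{w}} (f : GeomMorph E F) (g : GeomMorph F G) : GeomMorph E G where
  inverse := g.inverse ⋙ f.inverse
  direct := f.direct ⋙ g.direct
  adj := g.adj.comp f.adj
  lex := by
    have := f.lex
    have := g.lex
    exact Limits.comp_preservesFiniteLimits _ _

/-- The 2-cells are the natural transformations between inverse images. -/
@[ext]
structure Hom {E F : Topos.{w}} (f g : GeomMorph E F) where
  nat : f.inverse ⟶ g.inverse

instance (E F : Topos.{w}) : Category (GeomMorph E F) where
  Hom f g := Hom f g
  id f := ⟨𝟙 f.inverse⟩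
  comp α β := ⟨α.nat ≫ β.nat⟩

@[ext]
theorem hom_ext {E F : Topos.{w}} {f g : GeomMorph E F} {α β : f ⟶ g}
    (h : α.nat = β.nat) : α = β := Hom.ext h

theorem ext_app {E F : Topos.{w}} {f g : GeomMorph E F} {α β : f ⟶ g}
    (h : ∀ X, α.nat.app X = β.nat.app X) : α = β := hom_ext (NatTrans.ext (funext h))

@[simp]
theorem id_nat {E F : Topos.{w}} (f : GeomMorph E F) : Hom.nat (𝟙 f) = 𝟙 f.inverse := rfl

@[simp]
theorem comp_nat {E F : Topos.{w}} {f g h : GeomMorph E F} (α : f ⟶ g) (β : g ⟶ h) :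
    (α ≫ β).nat = α.nat ≫ β.nat := rfl

/-- An invertible natural transformation of inverse images is an invertible 2-cell. -/
@[simps]
def isoMk {E F : Topos.{w}} {f g : GeomMorph E F} (i : f.inverse ≅ g.inverse) : f ≅ g where
  hom := ⟨i.hom⟩
  inv := ⟨i.inv⟩

/-- Whiskering of a 2-cell with a 1-cell on the left. -/
@[simps]
def whiskerLeft {E F G : Topos.{w}} (f : GeomMorph E F) {g h : GeomMorph F G} (η : g ⟶ h) :
    f.comp g ⟶ f.comp h where
  nat := Functor.whiskerRight η.nat f.inverse

/-- Whiskering of a 2-cell with a 1-cell on the right. -/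
@[simps]
def whiskerRight {E F G : Topos.{w}} {f g : GeomMorph E F} (η : f ⟶ g) (h : GeomMorph F G) :
    f.comp h ⟶ g.comp h where
  nat := Functor.whiskerLeft h.inverse η.nat

/-- The associator. -/
@[simps!]
def associator {E F G H : Topos.{w}} (f : GeomMorph E F) (g : GeomMorph F G) (h : GeomMorph G H) :
    (f.comp g).comp h ≅ f.comp (g.comp h) :=
  isoMk (Functor.associator h.inverse g.inverse f.inverse).symm

/-- The left unitor. -/
@[simps!]
def leftUnitor {E F : Topos.{w}} (f : GeomMorph E F) : (id E).comp f ≅ f :=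
  isoMk (Functor.rightUnitor f.inverse)

/-- The right unitor. -/
@[simps!]
def rightUnitor {E F : Topos.{w}} (f : GeomMorph E F) : f.comp (id F) ≅ f :=
  isoMk (Functor.leftUnitor f.inverse)

end GeomMorph

/-- The 2-category of Grothendieck topoi, geometric morphisms, and natural transformations between
inverse images. -/
instance : Bicategory Topos.{w} where
  Hom E F := GeomMorph E F
  id E := GeomMorph.id E
  comp f g := GeomMorph.comp f g
  whiskerLeft f _ _ η := f.whiskerLeft η
  whiskerRight η h := GeomMorph.whiskerRight η h
  associator f g h := f.associator g h
  leftUnitor f := f.leftUnitor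
  rightUnitor f := f.rightUnitor
  whiskerLeft_id f _ := GeomMorph.ext_app fun _ => f.inverse.map_id _
  whiskerLeft_comp f _ _ _ _ _ := GeomMorph.ext_app fun _ => f.inverse.map_comp _ _
  id_whiskerLeft η := GeomMorph.ext_app fun X =>
    show (GeomMorph.Hom.nat η).app X = 𝟙 _ ≫ (GeomMorph.Hom.nat η).app X ≫ 𝟙 _ by simp
  comp_whiskerLeft f g _ _ η := GeomMorph.ext_app fun X =>
    show f.inverse.map (g.inverse.map ((GeomMorph.Hom.nat η).app X)) =
      𝟙 _ ≫ f.inverse.map (g.inverse.map ((GeomMorph.Hom.nat η).app X)) ≫ 𝟙 _ by simp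
  id_whiskerRight _ _ := GeomMorph.ext_app fun _ => rfl
  comp_whiskerRight _ _ _ := GeomMorph.ext_app fun _ => rfl
  whiskerRight_id η := GeomMorph.ext_app fun X =>
    show (GeomMorph.Hom.nat η).app X = 𝟙 _ ≫ (GeomMorph.Hom.nat η).app X ≫ 𝟙 _ by simp
  whiskerRight_comp η g h := GeomMorph.ext_app fun X =>
    show (GeomMorph.Hom.nat η).app (g.inverse.obj (h.inverse.obj X)) =
      𝟙 _ ≫ (GeomMorph.Hom.nat η).app (g.inverse.obj (h.inverse.obj X)) ≫ 𝟙 _ by simp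
  whisker_assoc f _ _ η h := GeomMorph.ext_app fun X =>
    show f.inverse.map ((GeomMorph.Hom.nat η).app (h.inverse.obj X)) =
      𝟙 _ ≫ f.inverse.map ((GeomMorph.Hom.nat η).app (h.inverse.obj X)) ≫ 𝟙 _ by simp
  whisker_exchange η θ := GeomMorph.ext_app fun X => (GeomMorph.Hom.nat η).naturality ((GeomMorph.Hom.nat θ).app X)
  pentagon f g h i := GeomMorph.ext_app fun X =>
    show 𝟙 (f.inverse.obj (g.inverse.obj (h.inverse.obj (i.inverse.obj X)))) ≫ 𝟙 _ ≫
      f.inverse.map (𝟙 _) = 𝟙 _ ≫ 𝟙 _ by simp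
  triangle f g := GeomMorph.ext_app fun X =>
    show 𝟙 (f.inverse.obj (g.inverse.obj X)) ≫ f.inverse.map (𝟙 _) = 𝟙 _ by simp

/-- A geometric morphism is hyperconnected when its inverse image is fully faithful with essential
image closed under subobjects. -/
structure IsHyperconnected {E F : Topos.{w}} (f : GeomMorph E F) : Prop where
  full : f.inverse.Full
  faithful : f.inverse.Faithful
  closed : f.inverse.essImage.IsClosedUnderSubobjects

/-- The class of hyperconnected geometric morphisms. -/
def hyperconnected : OneCellClass Topos.{w} := fun E F f =>
  IsHyperconnected (E := E) (F := F) f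

/-- The topology on a frame for which a sieve on `U` covers when the join of its members is `U`. -/
def frameTopology (L : Type w) [Order.Frame L] : GrothendieckTopology L where
  sieves U := {S | U ≤ ⨆ (V : L) (f : V ⟶ U) (_ : S f), V}
  top_mem' U := le_iSup_of_le U (le_iSup_of_le (𝟙 U) (le_iSup_of_le trivial le_rfl))
  pullback_stable' U V S f hS := by
    have h : V ≤ V ⊓ ⨆ (W : L) (g : W ⟶ U) (_ : S g), W := le_inf le_rfl (f.le.trans hS)
    refine h.trans ?_
    simp only [inf_iSup_eq]
    refine iSup_le fun W => iSup_le fun g => iSup_le fun hg => ?_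
    refine le_iSup_of_le (V ⊓ W) (le_iSup_of_le (homOfLE inf_le_left) (le_iSup_of_le ?_ le_rfl))
    exact S.downward_closed hg (homOfLE inf_le_right)
  transitive' U S hS R hR := by
    refine le_trans hS ?_
    refine iSup_le fun V => iSup_le fun f => iSup_le fun hf => (hR hf).trans ?_
    refine iSup_le fun W => iSup_le fun g => iSup_le fun hg => ?_
    exact le_iSup_of_le W (le_iSup_of_le (g ≫ f) (le_iSup_of_le hg le_rfl))

/-- A topos is localic when it is equivalent to the topos of sheaves on a (small) locale, that is,
on a frame with its join topology. -/
def IsLocalic (E : Topos.{w}) : Prop :=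
  ∃ (L : Type w) (_ : Order.Frame L), Nonempty (E.carrier ≌ Sheaf (frameTopology L) (Type w))

/-- The full sub-2-category of localic topoi. -/
def LocTopoi : LocallyFullSub Topos.{w} := fullSub IsLocalic

end KanInj

namespace KanInj

open Opposite Limits

/-! ### The frame of subterminal sheaves on a site -/

/-- A set of objects of a site that is closed under maps into its members and under covers, that is,
a subterminal sheaf. -/
@[ext]
structure ClosedSet {C : Type w} [SmallCategory C] (J : GrothendieckTopology C) where
  carrier : Set C
  down : ∀ {c d : C} (_ : d ⟶ c), c ∈ carrier → d ∈ carrier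
  closed : ∀ {c : C} (S : Sieve c), S ∈ J c → (∀ {d : C} (f : d ⟶ c), S f → d ∈ carrier) →
    c ∈ carrier

namespace ClosedSet

variable {C : Type w} [SmallCategory C] {J : GrothendieckTopology C}

instance : PartialOrder (ClosedSet J) :=
  PartialOrder.lift carrier fun _ _ h => ClosedSet.ext h

instance : InfSet (ClosedSet J) where
  sInf A :=
    { carrier := {c | ∀ U ∈ A, c ∈ U.carrier}
      down := fun f h U hU => U.down f (h U hU)
      closed := fun S hS h U hU => U.closed S hS fun f hf => h f hf U hU }

/-- The binary meet is supplied explicitly so that membership in it unfolds to a conjunction. -/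
instance : CompleteLattice (ClosedSet J) where
  __ := completeLatticeOfInf (ClosedSet J) fun _ =>
    ⟨fun U hU _ hc => hc U hU, fun _ hV _ hc _ hU => hV hU hc⟩
  inf U V :=
    { carrier := U.carrier ∩ V.carrier
      down := fun f h => ⟨U.down f h.1, V.down f h.2⟩
      closed := fun S hS h =>
        ⟨U.closed S hS fun f hf => (h f hf).1, V.closed S hS fun f hf => (h f hf).2⟩ }
  inf_le_left _ _ _ h := h.1
  inf_le_right _ _ _ h := h.2
  le_inf _ _ _ h k _ hc := ⟨h hc, k hc⟩

/-- The Heyting implication of closed sets. -/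
def imp (U V : ClosedSet J) : ClosedSet J where
  carrier := {c | ∀ ⦃d : C⦄ (_ : d ⟶ c), d ∈ U.carrier → d ∈ V.carrier}
  down f h _ g := h (g ≫ f)
  closed S hS h _ g hd := V.closed (S.pullback g) (J.pullback_stable g hS) fun f hf =>
    h (f ≫ g) hf (𝟙 _) (U.down f hd)

instance : Order.Frame (ClosedSet J) :=
  Order.Frame.ofMinimalAxioms
    { inf_sSup_le_iSup_inf := fun U A => by
        -- Joins are only known as least upper bounds; the adjunction between `U ⊓ ·` and `imp U`
        -- gives distributivity without describing their elements.
        have h : sSup A ≤ imp U (⨆ V ∈ A, U ⊓ V) := sSup_le fun V hV c hc d f hd =>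
          le_iSup₂_of_le (f := fun V (_ : V ∈ A) => U ⊓ V) V hV le_rfl ⟨hd, V.down f hc⟩
        exact fun c hc => h hc.2 (𝟙 c) hc.1 }

/-- The closure of a sieve of objects. -/
def closure (D : Set C) (_hD : ∀ ⦃c d : C⦄ (_ : d ⟶ c), c ∈ D → d ∈ D) : ClosedSet J where
  carrier := {c | ∃ S ∈ J c, ∀ ⦃d : C⦄ (f : d ⟶ c), S f → d ∈ D}
  down := by
    rintro d e f ⟨S, hS, h⟩
    exact ⟨S.pullback f, J.pullback_stable f hS, fun e' g hg => h (g ≫ f) hg⟩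
  closed := by
    intro d S hS h
    choose R hR hRc using @h
    exact ⟨Sieve.bind S fun e f hf => R f hf, J.bind_covering hS fun e f hf => hR f hf, by
      rintro e f ⟨e', g, g', hg', hg, rfl⟩
      exact hRc g' hg' g hg⟩

theorem mem_closure_of_mem {D : Set C} {hD : ∀ ⦃c d : C⦄ (_ : d ⟶ c), c ∈ D → d ∈ D} {c : C}
    (hc : c ∈ D) : c ∈ (closure (J := J) D hD).carrier :=
  ⟨⊤, J.top_mem c, fun _ f _ => hD f hc⟩

variable (J) in
/-- The closed set generated by an object. -/
def gen (c : C) : ClosedSet J :=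
  closure {d | Nonempty (d ⟶ c)} fun _ _ f h => ⟨f ≫ h.some⟩

theorem mem_gen_of_hom {c d : C} (f : d ⟶ c) : d ∈ (gen J c).carrier :=
  mem_closure_of_mem ⟨f⟩

theorem mem_gen (c : C) : c ∈ (gen J c).carrier := mem_gen_of_hom (𝟙 c)

theorem gen_le {c : C} {U : ClosedSet J} : gen J c ≤ U ↔ c ∈ U.carrier := by
  refine ⟨fun h => h (mem_gen c), fun h d => ?_⟩
  rintro ⟨S, hS, hSc⟩
  exact U.closed S hS fun f hf => U.down (hSc f hf).some h

theorem gen_mono {c d : C} (f : d ⟶ c) : gen J d ≤ gen J c := gen_le.2 (mem_gen_of_hom f)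

variable (J) in
/-- The functor sending an object to the closed set that it generates. -/
def genFunctor : C ⥤ ClosedSet J where
  obj := gen J
  map f := homOfLE (gen_mono f)

/-- A join of closed sets lies in the closure of their union, so if it contains `c`, then `c` has a
`J`-cover by objects of the individual members. This makes right Kan extension along `genFunctor J`
preserve sheaves, which provides the direct image. -/
instance : (genFunctor J).IsCocontinuous J (frameTopology (ClosedSet J)) where
  cover_lift {c S} hS := by
    have h : gen J c ≤ closure {d | ∃ (V : ClosedSet J) (f : V ⟶ gen J c), S f ∧ d ∈ V.carrier}
        fun _ _ f ⟨V, g, hg, h⟩ => ⟨V, g, hg, V.down f h⟩ :=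
      le_trans hS (iSup_le fun V => iSup_le fun f => iSup_le fun hf d hd =>
        mem_closure_of_mem ⟨V, f, hf, hd⟩)
    obtain ⟨R, hR, h⟩ := gen_le.1 h
    refine J.superset_covering (fun d f hf => ?_) hR
    obtain ⟨V, g, hg, hd⟩ := h f hf
    exact S.downward_closed hg (homOfLE (gen_le.2 hd))

end ClosedSet

/-! ### Sheaves on a frame -/

section Frame

variable {L : Type w} [Order.Frame L]

theorem ofArrows_mem_frameTopology {ι : Type*} {U : L} {V : ι → L} (f : ∀ i, V i ⟶ U)
    (h : U ≤ ⨆ i, V i) : Sieve.generate (Presieve.ofArrows V f) ∈ frameTopology L U :=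
  h.trans (iSup_le fun i => le_iSup_of_le (V i) (le_iSup_of_le (f i)
    (le_iSup_of_le (Sieve.le_generate _ _ _ (Presieve.ofArrows.mk i)) le_rfl)))

/-- Gluing of sections of a sheaf on a frame. -/
theorem existsUnique_gluing (F : Sheaf (frameTopology L) (Type w)) {ι : Type*} {U : L} {V : ι → L}
    (f : ∀ i, V i ⟶ U) (h : U ≤ ⨆ i, V i) (x : ∀ i, F.obj.obj (op (V i)))
    (hx : ∀ i j, F.obj.map (homOfLE (inf_le_left : V i ⊓ V j ≤ V i)).op (x i) =
      F.obj.map (homOfLE (inf_le_right : V i ⊓ V j ≤ V j)).op (x j)) :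
    ∃! t : F.obj.obj (op U), ∀ i, F.obj.map (f i).op t = x i := by
  have hF := (isSheaf_iff_isSheaf_of_type _ _).1 F.property _ (ofArrows_mem_frameTopology f h)
  rw [← Presieve.isSheafFor_iff_generate, Presieve.isSheafFor_arrows_iff] at hF
  -- Any `W` below `V i` and `V j` lies below their meet, so agreement on meets suffices.
  refine hF x fun i j W gi gj _ => ?_
  have h1 : gi.op = (homOfLE (inf_le_left : V i ⊓ V j ≤ V i)).op ≫
      (homOfLE (le_inf gi.le gj.le)).op := rfl
  have h2 : gj.op = (homOfLE (inf_le_right : V i ⊓ V j ≤ V j)).op ≫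
      (homOfLE (le_inf gi.le gj.le)).op := rfl
  rw [h1, h2, Functor.map_comp_apply, Functor.map_comp_apply, hx]

theorem section_ext (F : Sheaf (frameTopology L) (Type w)) {ι : Type*} {U : L} {V : ι → L}
    (f : ∀ i, V i ⟶ U) (h : U ≤ ⨆ i, V i) {x y : F.obj.obj (op U)}
    (hxy : ∀ i, F.obj.map (f i).op x = F.obj.map (f i).op y) : x = y :=
  (existsUnique_gluing F f h (fun i => F.obj.map (f i).op x) fun i j => by
    rw [← Functor.map_comp_apply, ← Functor.map_comp_apply]
    rfl).unique (fun _ => rfl) fun i => (hxy i).symm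

end Frame

/-! ### The localic reflection of the topos of sheaves on a site -/

section LocalicReflection

variable {C : Type w} [SmallCategory C] {J : GrothendieckTopology C}

open ClosedSet

theorem le_iSup_gen (U : ClosedSet J) : U ≤ ⨆ c : {c // c ∈ U.carrier}, gen J c.1 :=
  fun c hc => le_iSup (fun c : {c // c ∈ U.carrier} => gen J c.1) ⟨c, hc⟩ (mem_gen c)

/-- A sheaf on the frame of closed sets, as a presheaf on the site. -/
abbrev genRestrict (F : Sheaf (frameTopology (ClosedSet J)) (Type w)) : Cᵒᵖ ⥤ Type w :=
  (genFunctor J).op ⋙ F.obj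

/-- Restriction of a section over a closed set to an object belonging to it. -/
abbrev germ (F : Sheaf (frameTopology (ClosedSet J)) (Type w)) {U : ClosedSet J}
    (t : F.obj.obj (op U)) (c : C) (hc : c ∈ U.carrier) : (genRestrict F).obj (op c) :=
  F.obj.map (homOfLE (gen_le.2 hc)).op t

theorem map_germ (F : Sheaf (frameTopology (ClosedSet J)) (Type w)) {U : ClosedSet J}
    (t : F.obj.obj (op U)) {c d : C} (hc : c ∈ U.carrier) (f : d ⟶ c) :
    (genRestrict F).map f.op (germ F t c hc) = germ F t d (U.down f hc) :=
  (F.obj.map_comp_apply (homOfLE (gen_le.2 hc)).op (homOfLE (gen_mono f)).op t).symm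

theorem germ_map (F : Sheaf (frameTopology (ClosedSet J)) (Type w)) {U V : ClosedSet J}
    (t : F.obj.obj (op U)) (f : V ⟶ U) {c : C} (hc : c ∈ V.carrier) :
    germ F (F.obj.map f.op t) c hc = germ F t c (f.le hc) :=
  (F.obj.map_comp_apply f.op (homOfLE (gen_le.2 hc)).op t).symm

theorem germ_gen (F : Sheaf (frameTopology (ClosedSet J)) (Type w)) {c : C}
    (t : F.obj.obj (op (gen J c))) : germ F t c (mem_gen c) = t :=
  ConcreteCategory.congr_hom (F.obj.map_id (op (gen J c))) t

theorem germ_naturality {F G : Sheaf (frameTopology (ClosedSet J)) (Type w)} (ψ : F.obj ⟶ G.obj)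
    {U : ClosedSet J} (t : F.obj.obj (op U)) {c : C} (hc : c ∈ U.carrier) :
    germ G (ψ.app _ t) c hc = ψ.app _ (germ F t c hc) :=
  (NatTrans.naturality_apply ψ (homOfLE (gen_le.2 hc)).op t).symm

theorem germ_ext (F : Sheaf (frameTopology (ClosedSet J)) (Type w)) {U : ClosedSet J}
    {x y : F.obj.obj (op U)} (h : ∀ c hc, germ F x c hc = germ F y c hc) : x = y :=
  section_ext F (fun c : {c // c ∈ U.carrier} => homOfLE (gen_le.2 c.2)) (le_iSup_gen U)
    fun c => h c.1 c.2

section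

variable {F : Sheaf (frameTopology (ClosedSet J)) (Type w)} {Q : Sheaf J (Type w)}
  (φ : genRestrict F ⟶ Q.obj)

/-- A `J`-cover of `c` generates a cover of `gen J c` in the frame, and `F` is separated for it. So
local injectivity is already objectwise injectivity. -/
theorem injective_app_of_isLocallyInjective [Presheaf.IsLocallyInjective J φ] (c : C) :
    Function.Injective (φ.app (op c)) := by
  intro x y h
  have hS := Presheaf.equalizerSieve_mem J φ x y h
  refine section_ext F
    (fun i : {f : Over c // Presheaf.equalizerSieve (F := genRestrict F) x y f.hom} => homOfLE (gen_mono i.1.hom))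
    (gen_le.2 (ClosedSet.closed _ _ hS fun {d} f hf => ?_)) fun i => i.2
  exact le_iSup (fun i : {f : Over c // Presheaf.equalizerSieve (F := genRestrict F) x y f.hom} => gen J i.1.left)
    ⟨Over.mk f, hf⟩ (mem_gen d)

/-- A compatible family of sections of the associated sheaf of `genRestrict F`, over the objects
of a closed set `U`, comes from a unique section of `F` over `U`. -/
theorem existsUnique_germ [Presheaf.IsLocallyInjective J φ] [Presheaf.IsLocallySurjective J φ]
    (U : ClosedSet J) (s : ∀ c, c ∈ U.carrier → Q.obj.obj (op c))
    (hs : ∀ ⦃c d : C⦄ (hc : c ∈ U.carrier) (f : d ⟶ c),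
      Q.obj.map f.op (s c hc) = s d (U.down f hc)) :
    ∃! t : F.obj.obj (op U), ∀ c hc, φ.app (op c) (germ F t c hc) = s c hc := by
  have inj := injective_app_of_isLocallyInjective φ
  refine existsUnique_of_exists_of_unique ?_ fun t t' h h' =>
    germ_ext F fun c hc => inj c ((h c hc).trans (h' c hc).symm)
  -- The sections to be glued are all preimages of values of `s`; local surjectivity makes their
  -- domains cover `U`.
  let ι := Σ c : {c // c ∈ U.carrier},
    {x : F.obj.obj (op (gen J c.1)) // φ.app (op c.1) x = s c.1 c.2}
  have cover : U ≤ ⨆ i : ι, gen J i.1.1 := fun c hc =>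
    ClosedSet.closed _ _ (Presheaf.imageSieve_mem J φ (s c hc)) fun {d} f ⟨x, hx⟩ =>
      le_iSup (fun i : ι => gen J i.1.1) ⟨⟨d, U.down f hc⟩, x, hx.trans (hs hc f)⟩ (mem_gen d)
  obtain ⟨t, ht, -⟩ := existsUnique_gluing F
    (fun i : ι => homOfLE (gen_le.2 i.1.2)) cover (fun i => i.2.1) (by
      rintro ⟨⟨c, hc⟩, x, hx⟩ ⟨⟨d, hd⟩, y, hy⟩
      -- The meet of `gen J c` and `gen J d` is covered by the objects mapping to both `c` and `d`;
      -- there the two preimages agree by injectivity of `φ`.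
      refine section_ext F
        (fun e : {e // Nonempty (e ⟶ c) ∧ Nonempty (e ⟶ d)} => homOfLE
          (le_inf (gen_mono e.2.1.some) (gen_mono e.2.2.some))) ?_ ?_
      · rintro e ⟨⟨S, hS, hSc⟩, R, hR, hRd⟩
        refine ClosedSet.closed _ _ (J.intersection_covering hS hR) fun {e'} f hf => ?_
        exact le_iSup (fun e : {e // Nonempty (e ⟶ c) ∧ Nonempty (e ⟶ d)} => gen J e.1)
          ⟨e', hSc f hf.1, hRd f hf.2⟩ (mem_gen e')
      · rintro ⟨e, ⟨f⟩, ⟨g⟩⟩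
        rw [← Functor.map_comp_apply, ← Functor.map_comp_apply]
        refine inj e ?_
        have h1 := NatTrans.naturality_apply φ f.op x
        have h2 := NatTrans.naturality_apply φ g.op y
        rw [hx, hs] at h1
        rw [hy, hs] at h2
        exact h1.trans h2.symm)
  refine ⟨t, fun c hc => ?_⟩
  -- The gluing controls `t` only where `s` has a preimage; separatedness of `Q` extends the
  -- equality to all of `U`.
  refine (((isSheaf_iff_isSheaf_of_type _ _).1 Q.property).isSeparated _
    (Presheaf.imageSieve_mem J φ (s c hc))).ext ?_
  rintro d f ⟨x, hx⟩
  rw [← NatTrans.naturality_apply, map_germ, ← hx]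
  exact congrArg _ (ht ⟨⟨d, U.down f hc⟩, x, hx.trans (hs hc f)⟩)

end

variable (J) in
/-- The inverse image part of the geometric morphism from the sheaves on a site to the sheaves on
its frame of subterminal sheaves. -/
noncomputable def reflInverse :
    Sheaf (frameTopology (ClosedSet J)) (Type w) ⥤ Sheaf J (Type w) :=
  sheafToPresheaf _ _ ⋙ (Functor.whiskeringLeft _ _ _).obj (genFunctor J).op ⋙
    presheafToSheaf J (Type w)

variable (J) in
/-- The direct image part. -/
noncomputable def reflDirect :
    Sheaf J (Type w) ⥤ Sheaf (frameTopology (ClosedSet J)) (Type w) :=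
  (genFunctor J).sheafPushforwardCocontinuous (Type w) J (frameTopology (ClosedSet J))

variable (J) in
/-- The inverse image is left adjoint to the direct image. -/
noncomputable def reflAdj : reflInverse J ⊣ reflDirect J :=
  (((genFunctor J).op.ranAdjunction (Type w)).comp
    (sheafificationAdjunction J (Type w))).restrictFullyFaithful
      (fullyFaithfulSheafToPresheaf _ _) (Functor.FullyFaithful.id _)
      (Iso.refl _) (Iso.refl _)

instance : PreservesFiniteLimits (reflInverse J) := by
  have : PreservesFiniteLimits
      (sheafToPresheaf (frameTopology (ClosedSet J)) (Type w)) := inferInstance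
  have : PreservesFiniteLimits ((Functor.whiskeringLeft _ _ (Type w)).obj (genFunctor J).op) :=
    inferInstance
  have : PreservesFiniteLimits (presheafToSheaf J (Type w)) := inferInstance
  have := comp_preservesFiniteLimits ((Functor.whiskeringLeft _ _ (Type w)).obj (genFunctor J).op)
    (presheafToSheaf J (Type w))
  exact comp_preservesFiniteLimits _ _

/-- The universal map to the inverse image. -/
noncomputable def reflUnit (F : Sheaf (frameTopology (ClosedSet J)) (Type w)) :
    genRestrict F ⟶ ((reflInverse J).obj F).obj :=
  toSheafify J (genRestrict F)

instance (F : Sheaf (frameTopology (ClosedSet J)) (Type w)) :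
    Presheaf.IsLocallyInjective J (reflUnit F) :=
  Presheaf.isLocallyInjective_toSheafify' J _

instance (F : Sheaf (frameTopology (ClosedSet J)) (Type w)) :
    Presheaf.IsLocallySurjective J (reflUnit F) :=
  Presheaf.isLocallySurjective_toSheafify' J _

theorem reflUnit_naturality {F G : Sheaf (frameTopology (ClosedSet J)) (Type w)} (ψ : F ⟶ G) :
    reflUnit F ≫ ((reflInverse J).map ψ).hom =
      Functor.whiskerLeft (genFunctor J).op ψ.hom ≫ reflUnit G :=
  (toSheafify_naturality J (Functor.whiskerLeft (genFunctor J).op ψ.hom)).symm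

theorem reflInverse_hom_ext {F : Sheaf (frameTopology (ClosedSet J)) (Type w)}
    {Q : Sheaf J (Type w)} {α β : (reflInverse J).obj F ⟶ Q}
    (h : reflUnit F ≫ α.hom = reflUnit F ≫ β.hom) : α = β :=
  Sheaf.hom_ext (sheafify_hom_ext J _ _ Q.property h)

instance : (reflInverse J).Faithful where
  map_injective {F G ψ ψ'} h := by
    refine Sheaf.hom_ext (NatTrans.ext (funext fun ⟨U⟩ => ConcreteCategory.hom_ext _ _ fun x => ?_))
    refine germ_ext G fun c hc => injective_app_of_isLocallyInjective (reflUnit G) c ?_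
    rw [germ_naturality, germ_naturality]
    have h1 := reflUnit_naturality ψ
    rw [h, reflUnit_naturality ψ'] at h1
    exact (ConcreteCategory.congr_hom (NatTrans.congr_app h1 (op c)) (germ F x c hc)).symm

/-- The germs of a section, pushed through `α`, form a compatible family that `existsUnique_germ`
lifts to a section of `G`; uniqueness of the lift gives naturality. -/
instance : (reflInverse J).Full where
  map_surjective {F G} α := by
    have key (U : ClosedSet J) (x : F.obj.obj (op U)) := existsUnique_germ (reflUnit G) U
      (fun c hc => (reflUnit F ≫ α.hom).app (op c) (germ F x c hc)) fun c d hc f => by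
        rw [← NatTrans.naturality_apply, map_germ]
    choose ψ hψ huniq using key
    let ψ' : F.obj ⟶ G.obj :=
      { app := fun U => ↾(ψ U.unop)
        naturality := by
          rintro ⟨U⟩ ⟨V⟩ f
          refine ConcreteCategory.hom_ext _ _ fun x => (huniq V _ _ fun c hc => ?_).symm
          exact (congrArg _ (germ_map G (ψ U x) f.unop hc)).trans ((hψ U x c _).trans
            (congrArg _ (germ_map F x f.unop hc).symm)) }
    refine ⟨⟨ψ'⟩, reflInverse_hom_ext ?_⟩
    rw [reflUnit_naturality]
    refine NatTrans.ext (funext fun ⟨c⟩ => ConcreteCategory.hom_ext _ _ fun x => ?_)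
    exact (congrArg _ (germ_gen G _).symm).trans ((hψ (gen J c) x c (mem_gen c)).trans
      (congrArg _ (germ_gen F x)))

/-! ### Subobjects of an inverse image -/

section Subobjects

variable {X Y Z : Sheaf J (Type w)} (m : X ⟶ Z) (i : Y ⟶ Z)

theorem injective_app_of_mono [Mono m] (c : C) : Function.Injective (m.hom.app (op c)) := by
  have : Mono m.hom := inferInstanceAs (Mono ((sheafToPresheaf J (Type w)).map m))
  exact (mono_iff_injective _).1 inferInstance

/-- Preimages under a monomorphism are unique, so local ones are compatible and glue. -/
theorem mem_range_of_locally_mem_range [Mono m] {c : C} (z : Z.obj.obj (op c)) {S : Sieve c}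
    (hS : S ∈ J c)
    (h : ∀ ⦃d : C⦄ (f : d ⟶ c), S f → ∃ x, m.hom.app (op d) x = Z.obj.map f.op z) :
    ∃ x, m.hom.app (op c) x = z := by
  choose x hx using h
  obtain ⟨t, ht, -⟩ := (isSheaf_iff_isSheaf_of_type _ _).1 X.property S hS x (by
    intro d d' e g g' f f' hf hf' hff
    refine injective_app_of_mono m e ?_
    rw [NatTrans.naturality_apply, NatTrans.naturality_apply, hx, hx, ← Functor.map_comp_apply,
      ← Functor.map_comp_apply, ← op_comp, ← op_comp, hff])
  refine ⟨t, (((isSheaf_iff_isSheaf_of_type _ _).1 Z.property).isSeparated _ hS).ext ?_⟩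
  intro d f hf
  rw [← NatTrans.naturality_apply, ht f hf, hx]

theorem exists_lift_of_range_le [Mono m]
    (h : ∀ (c : C) (y : Y.obj.obj (op c)), ∃ x, m.hom.app (op c) x = i.hom.app (op c) y) :
    ∃ k : Y ⟶ X, k ≫ m = i := by
  choose k hk using h
  let k' : Y.obj ⟶ X.obj :=
    { app := fun c => ↾(k c.unop)
      naturality := by
        rintro ⟨c⟩ ⟨d⟩ f
        refine ConcreteCategory.hom_ext _ _ fun y => injective_app_of_mono m d ?_
        exact (hk d _).trans ((NatTrans.naturality_apply i.hom f y).trans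
          ((congrArg _ (hk c y).symm).trans (NatTrans.naturality_apply m.hom f _).symm)) }
  exact ⟨⟨k'⟩, Sheaf.hom_ext (NatTrans.ext (funext fun ⟨c⟩ =>
    ConcreteCategory.hom_ext _ _ fun y => hk c y))⟩

theorem nonempty_iso_of_range_eq [Mono m] [Mono i]
    (h : ∀ (c : C) (y : Y.obj.obj (op c)), ∃ x, m.hom.app (op c) x = i.hom.app (op c) y)
    (h' : ∀ (c : C) (x : X.obj.obj (op c)), ∃ y, i.hom.app (op c) y = m.hom.app (op c) x) :
    Nonempty (Y ≅ X) := by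
  obtain ⟨k, hk⟩ := exists_lift_of_range_le m i h
  obtain ⟨l, hl⟩ := exists_lift_of_range_le i m h'
  exact ⟨k, l, by rw [← cancel_mono i, Category.assoc, hl, hk, Category.id_comp],
    by rw [← cancel_mono m, Category.assoc, hk, hl, Category.id_comp]⟩

variable {F : Sheaf (frameTopology (ClosedSet J)) (Type w)} {X : Sheaf J (Type w)}
  (m : X ⟶ (reflInverse J).obj F)

/-- The sections of `F` that belong to a subobject of its inverse image. -/
def subobjectSections : Subfunctor F.obj where
  obj U := {t | ∀ c (hc : c ∈ U.unop.carrier),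
    ∃ x, m.hom.app (op c) x = (reflUnit F).app (op c) (germ F t c hc)}
  map {U V} f t ht c hc := by
    obtain ⟨x, hx⟩ := ht c (f.unop.le hc)
    exact ⟨x, hx.trans (congrArg _ (germ_map F t f.unop hc).symm)⟩

theorem isSheaf_subobjectSections [Mono m] :
    Presheaf.IsSheaf (frameTopology (ClosedSet J)) (subobjectSections m).toFunctor := by
  rw [isSheaf_iff_isSheaf_of_type, Subfunctor.isSheaf_iff _
    ((isSheaf_iff_isSheaf_of_type _ _).1 F.property)]
  rintro ⟨U⟩ t ht
  -- The objects over which `t` lies in the subobject form a closed set, so it suffices that `W`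
  -- contains each member of a cover of `U`.
  let W : ClosedSet J :=
    { carrier := {c | ∃ hc : c ∈ U.carrier,
        ∃ x, m.hom.app (op c) x = (reflUnit F).app (op c) (germ F t c hc)}
      down := by
        rintro c d f ⟨hc, x, hx⟩
        refine ⟨U.down f hc, X.obj.map f.op x, ?_⟩
        rw [NatTrans.naturality_apply, hx, ← NatTrans.naturality_apply, map_germ]
      closed := by
        intro c S hS h
        have hc := U.closed S hS fun f hf => (h f hf).1
        refine ⟨hc, mem_range_of_locally_mem_range m _ hS fun d f hf => ?_⟩
        rw [← NatTrans.naturality_apply, map_germ]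
        exact (h f hf).2 }
  have hW : U ≤ W := le_trans ht (iSup_le fun V => iSup_le fun f => iSup_le fun hf c hc => by
    obtain ⟨x, hx⟩ := hf c hc
    exact ⟨f.le hc, x, hx.trans (congrArg _ (germ_map F t f hc))⟩)
  exact fun c hc => (hW hc).2

instance : (reflInverse J).essImage.IsClosedUnderSubobjects where
  prop_of_mono {X Z} m _ := by
    rintro ⟨F, ⟨e⟩⟩
    let m' : X ⟶ (reflInverse J).obj F := m ≫ e.inv
    have : Mono m' := mono_comp _ _
    let F' : Sheaf (frameTopology (ClosedSet J)) (Type w) := ⟨_, isSheaf_subobjectSections m'⟩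
    let ι : F' ⟶ F := ⟨(subobjectSections m').ι⟩
    have : Mono ι := (sheafToPresheaf _ _).mono_of_mono_map
      (inferInstanceAs (Mono (subobjectSections m').ι))
    let i := (reflInverse J).map ι
    have hi (c : C) (t : F'.obj.obj (op (gen J c))) :
        i.hom.app (op c) ((reflUnit F').app (op c) t) = (reflUnit F).app (op c) t.1 :=
      ConcreteCategory.congr_hom (NatTrans.congr_app (reflUnit_naturality ι) (op c)) t
    refine ⟨F', nonempty_iso_of_range_eq m' i (fun c z => ?_) fun c x => ?_⟩
    · refine mem_range_of_locally_mem_range m' _ (Presheaf.imageSieve_mem J (reflUnit F') z) ?_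
      rintro d f ⟨t, ht⟩
      rw [← NatTrans.naturality_apply, ← ht]
      obtain ⟨x, hx⟩ := t.2 d (mem_gen d)
      exact ⟨x, (hx.trans (congrArg _ (germ_gen F t.1))).trans (hi d t).symm⟩
    · refine mem_range_of_locally_mem_range i _
        (Presheaf.imageSieve_mem J (reflUnit F) (m'.hom.app (op c) x)) ?_
      rintro d f ⟨t, ht⟩
      refine ⟨(reflUnit F').app (op d) ⟨t, ?_⟩, (hi d _).trans ht⟩
      -- Objects of `gen J d` map to `d` only locally. On such a cover the germ of `t` is a
      -- restriction of `t` along a map to `d`, and its image is a restriction of `x`.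
      intro e he
      obtain ⟨S, hS, h⟩ := id he
      refine mem_range_of_locally_mem_range m' _ hS fun e' g hg => ?_
      obtain ⟨k⟩ := h g hg
      rw [← NatTrans.naturality_apply, map_germ F t he g]
      refine ⟨X.obj.map k.op (X.obj.map f.op x), ?_⟩
      rw [NatTrans.naturality_apply, NatTrans.naturality_apply, ← ht,
        ← NatTrans.naturality_apply]
      rfl

end Subobjects

end LocalicReflection

/-! ### Kan extensions along hyperconnected geometric morphisms -/

section Extensions

variable {A B X : Topos.{w}} {f : A ⟶ B} {x : A ⟶ X}

theorem bijective_whiskerLeft (hf : hyperconnected f) (r s : B ⟶ X) :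
    Function.Bijective (fun β : r ⟶ s => f ◁ β) := by
  have := hf.full
  have := hf.faithful
  have h := (((Functor.FullyFaithful.ofFullyFaithful (GeomMorph.inverse f)).whiskeringRight
    X.carrier).homEquiv (X := GeomMorph.inverse r) (Y := GeomMorph.inverse s)).bijective
  refine ⟨fun β γ e => GeomMorph.hom_ext (h.1 (congrArg GeomMorph.Hom.nat e)), fun σ => ?_⟩
  obtain ⟨β, hβ⟩ := h.2 (GeomMorph.Hom.nat σ)
  exact ⟨⟨β⟩, GeomMorph.hom_ext hβ⟩

/-- The universal property is a composite of two bijections: whiskering with `f`, then composing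
with the invertible counit. -/
theorem isKan_of_isIso_counit (hf : hyperconnected f) (t : RightExtension f x) [IsIso t.counit] :
    Nonempty t.IsKan := by
  rw [rightKan_iff]
  intro y
  have h : Function.Bijective (fun β : f ≫ y ⟶ f ≫ t.extension => β ≫ t.counit) :=
    ⟨fun β γ e => (cancel_mono t.counit).1 e, fun β => ⟨β ≫ inv t.counit, by simp⟩⟩
  exact h.comp (bijective_whiskerLeft hf y t.extension)

theorem isKan_of_isIso_unit (hf : hyperconnected f) (t : LeftExtension f x) [IsIso t.unit] :
    Nonempty t.IsKan := by
  rw [leftKan_iff]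
  intro y
  have h : Function.Bijective (fun β : f ≫ t.extension ⟶ f ≫ y => t.unit ≫ β) :=
    ⟨fun β γ e => (cancel_epi t.unit).1 e, fun β => ⟨inv t.unit ≫ β, by simp⟩⟩
  exact h.comp (bijective_whiskerLeft hf t.extension y)

/-- A geometric morphism whose inverse image takes values in the essential image of the inverse
image of a hyperconnected `f` factors through `f`. -/
theorem exists_factorization (hf : hyperconnected f)
    (hx : ∀ Y, (GeomMorph.inverse f).essImage ((GeomMorph.inverse x).obj Y)) :
    ∃ r : B ⟶ X, Nonempty (f ≫ r ≅ x) := by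
  have := hf.full
  have := hf.faithful
  have := GeomMorph.lex x
  have (Y : X.carrier) : IsIso ((GeomMorph.adj f).counit.app ((GeomMorph.inverse x).obj Y)) :=
    ((GeomMorph.adj f).isIso_counit_app_iff_mem_essImage).2 (hx Y)
  let i : (GeomMorph.inverse x ⋙ GeomMorph.direct f) ⋙ GeomMorph.inverse f ≅
      GeomMorph.inverse x :=
    NatIso.ofComponents
      (fun Y => asIso ((GeomMorph.adj f).counit.app ((GeomMorph.inverse x).obj Y)))
      fun g => (GeomMorph.adj f).counit.naturality ((GeomMorph.inverse x).map g)
  have : PreservesLimits (GeomMorph.direct f) := (GeomMorph.adj f).rightAdjoint_preservesLimits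
  -- The inverse image of `r` is left exact because `f_*` is a right adjoint; its adjunction is that
  -- of `x`, restricted along the fully faithful `f^*`.
  let r : GeomMorph B X :=
    { inverse := GeomMorph.inverse x ⋙ GeomMorph.direct f
      direct := GeomMorph.inverse f ⋙ GeomMorph.direct x
      adj := (GeomMorph.adj x).restrictFullyFaithful (Functor.FullyFaithful.id _)
        (Functor.FullyFaithful.ofFullyFaithful (GeomMorph.inverse f)) i.symm (Iso.refl _)
      lex := comp_preservesFiniteLimits _ _ }
  exact ⟨r, ⟨GeomMorph.isoMk i⟩⟩

end Extensions

/-! ### Localic topoi are Kan injective -/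

theorem IsGrothendieckTopos.hasColimitsOfSize {E : Type (w + 1)} [Category.{w} E]
    (h : IsGrothendieckTopos E) : HasColimitsOfSize.{w, w} E := by
  obtain ⟨C, _, J, ⟨e⟩⟩ := h
  have : HasColimitsOfSize.{w, w} (Sheaf J (Type w)) :=
    hasColimits_of_reflective (sheafToPresheaf J (Type w))
  exact Adjunction.has_colimits_of_equivalence e.functor

theorem IsGrothendieckTopos.hasTerminal {E : Type (w + 1)} [Category.{w} E]
    (h : IsGrothendieckTopos E) : HasTerminal E := by
  obtain ⟨C, _, J, ⟨e⟩⟩ := h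
  exact Adjunction.hasLimitsOfShape_of_equivalence e.functor

section Localic

variable {A B X : Topos.{w}} {f : A ⟶ B}

theorem essImage_of_isLocalic (hf : hyperconnected f) (hX : IsLocalic X) (x : A ⟶ X)
    (Y : X.carrier) : (GeomMorph.inverse f).essImage ((GeomMorph.inverse x).obj Y) := by
  obtain ⟨L, _, ⟨e⟩⟩ := hX
  have := hf.full
  have := hf.faithful
  have := hf.closed
  have := GeomMorph.lex f
  have := GeomMorph.lex x
  have := B.isTopos.hasColimitsOfSize
  have := B.isTopos.hasTerminal
  have : PreservesColimits (GeomMorph.inverse x) := (GeomMorph.adj x).leftAdjoint_preservesColimits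
  have : PreservesColimits (GeomMorph.inverse f) := (GeomMorph.adj f).leftAdjoint_preservesColimits
  let K₁ := presheafToSheaf (frameTopology L) (Type w) ⋙ e.inverse
  have : PreservesFiniteLimits K₁ := comp_preservesFiniteLimits _ _
  have : PreservesColimits (presheafToSheaf (frameTopology L) (Type w)) :=
    (sheafificationAdjunction (frameTopology L) (Type w)).leftAdjoint_preservesColimits
  have : PreservesColimits K₁ := comp_preservesColimits _ _
  let K := K₁ ⋙ GeomMorph.inverse x
  have : PreservesFiniteLimits K := comp_preservesFiniteLimits _ _
  have : PreservesColimits K := comp_preservesColimits _ _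
  -- Representables on a poset are subterminal and `K` is left exact, so their images are subobjects
  -- of the terminal object, which is `f^*` of the terminal object.
  have hK (U : L) : (GeomMorph.inverse f).essImage (K.obj (uliftYoneda.{w}.obj U)) := by
    have : Mono (terminal.from (uliftYoneda.{w}.obj U)) := ⟨fun α β _ =>
      NatTrans.ext (funext fun V => ConcreteCategory.hom_ext _ _ fun z =>
        ULift.ext (α.app V z) (β.app V z) (Subsingleton.elim (α := V.unop ⟶ U) _ _))⟩
    refine ObjectProperty.prop_of_mono _ (K.map (terminal.from (uliftYoneda.{w}.obj U)))
      ⟨⊤_ B.carrier, ⟨?_⟩⟩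
    exact (terminalIsTerminal.isTerminalObj (GeomMorph.inverse f)).uniqueUpToIso
      (terminalIsTerminal.isTerminalObj K)
  let P := (e.functor.obj Y).obj
  -- `P` is a colimit of representables, `K` preserves it, and the essential image of the fully
  -- faithful, cocontinuous `f^*` is closed under colimits.
  have hP : (GeomMorph.inverse f).essImage (K.obj P) :=
    ObjectProperty.prop_of_isColimit _
      (isColimitOfPreserves K (Presheaf.colimitOfRepresentable.{w} P)) fun j => hK _
  exact ObjectProperty.prop_of_iso _ ((GeomMorph.inverse x).mapIso
    (e.inverse.mapIso (asIso ((sheafificationAdjunction (frameTopology L) (Type w)).counit.app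
      (e.functor.obj Y))) ≪≫ e.unitIso.symm.app Y)) hP

theorem exists_isKan_right (hf : hyperconnected f) (hX : IsLocalic X) (x : A ⟶ X) :
    ∃ t : RightExtension f x, Nonempty t.IsKan ∧ IsIso t.counit := by
  obtain ⟨r, ⟨i⟩⟩ := exists_factorization hf (essImage_of_isLocalic hf hX x)
  have : IsIso (RightExtension.mk r i.hom).counit := inferInstanceAs (IsIso i.hom)
  exact ⟨RightExtension.mk r i.hom, isKan_of_isIso_counit hf _, this⟩

theorem exists_isKan_left (hf : hyperconnected f) (hX : IsLocalic X) (x : A ⟶ X) :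
    ∃ t : LeftExtension f x, Nonempty t.IsKan ∧ IsIso t.unit := by
  obtain ⟨r, ⟨i⟩⟩ := exists_factorization hf (essImage_of_isLocalic hf hX x)
  have : IsIso (LeftExtension.mk r i.inv).unit := inferInstanceAs (IsIso i.inv)
  exact ⟨LeftExtension.mk r i.inv, isKan_of_isIso_unit hf _, this⟩

end Localic

/-! ### Uniqueness and preservation of Kan extensions -/

section Uniqueness

variable {B : Type u} [Bicategory.{w, v} B] {a b c : B} {f : a ⟶ b} {x : a ⟶ c}

/-- Preservation quantifies over every Kan extension, so invertibility must pass from the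
constructed one to all others. -/
theorem isIso_counit_of_isKan {s t : RightExtension f x} (hs : s.IsKan) (ht : t.IsKan)
    [IsIso s.counit] : IsIso t.counit := by
  let i : t ≅ s := IsTerminal.uniqueUpToIso ht hs
  have : IsIso i.hom.left := inferInstanceAs (IsIso ((CostructuredArrow.proj _ _).map i.hom))
  rw [show t.counit = f ◁ i.hom.left ≫ s.counit from (RightExtension.w i.hom).symm]
  infer_instance

theorem isIso_unit_of_isKan {s t : LeftExtension f x} (hs : s.IsKan) (ht : t.IsKan)
    [IsIso s.unit] : IsIso t.unit := by
  let i : s ≅ t := IsInitial.uniqueUpToIso hs ht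
  have : IsIso i.hom.right := inferInstanceAs (IsIso ((StructuredArrow.proj _ _).map i.hom))
  rw [show t.unit = s.unit ≫ f ◁ i.hom.right from (LeftExtension.w i.hom).symm]
  infer_instance

end Uniqueness

section

variable {X Y : Topos.{w}}

theorem IsLocalic.preservesRightKan (hX : IsLocalic X) (h : X ⟶ Y) :
    PreservesRightKan hyperconnected h := by
  rintro a b f hf x t ⟨ht⟩
  obtain ⟨s, ⟨hs⟩, _⟩ := exists_isKan_right hf hX x
  have := isIso_counit_of_isKan hs ht
  have : IsIso (rightWhisker t h).counit :=
    inferInstanceAs (IsIso ((α_ f t.extension h).inv ≫ t.counit ▷ h))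
  exact isKan_of_isIso_counit hf _

theorem IsLocalic.preservesLeftKan (hX : IsLocalic X) (h : X ⟶ Y) :
    PreservesLeftKan hyperconnected h := by
  rintro a b f hf x t ⟨ht⟩
  obtain ⟨s, ⟨hs⟩, _⟩ := exists_isKan_left hf hX x
  have := isIso_unit_of_isKan hs ht
  have : IsIso (t.whisker h).unit :=
    inferInstanceAs (IsIso (t.unit ▷ h ≫ (α_ f t.extension h).hom))
  exact isKan_of_isIso_unit hf _

end

/-! ### Kan injective topoi are localic -/

/-- Every topos has a hyperconnected geometric morphism to a topos of sheaves on a frame. -/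
theorem exists_hyperconnected (E : Topos.{w}) :
    ∃ (L : Type w) (_ : Order.Frame L) (F : Topos.{w}) (f : E ⟶ F),
      hyperconnected f ∧ Nonempty (F.carrier ≌ Sheaf (frameTopology L) (Type w)) := by
  obtain ⟨C, _, J, ⟨e⟩⟩ := E.isTopos
  let F : Topos.{w} := ⟨Sheaf (frameTopology (ClosedSet J)) (Type w),
    ⟨ClosedSet J, inferInstance, frameTopology (ClosedSet J), ⟨CategoryTheory.Equivalence.refl⟩⟩⟩
  let f : GeomMorph E F :=
    { inverse := reflInverse J ⋙ e.inverse
      direct := e.functor ⋙ reflDirect J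
      adj := (reflAdj J).comp e.symm.toAdjunction
      lex := comp_preservesFiniteLimits _ _ }
  refine ⟨ClosedSet J, inferInstance, F, f, ⟨?_, ?_, ⟨?_⟩⟩, ⟨CategoryTheory.Equivalence.refl⟩⟩
  · exact inferInstanceAs (reflInverse J ⋙ e.inverse).Full
  · exact inferInstanceAs (reflInverse J ⋙ e.inverse).Faithful
  · rintro X Z m _ ⟨G, ⟨i⟩⟩
    have hZ : (reflInverse J).essImage (e.functor.obj Z) :=
      ⟨G, ⟨(e.counitIso.app _).symm ≪≫ e.functor.mapIso i⟩⟩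
    obtain ⟨G', ⟨j⟩⟩ := ObjectProperty.prop_of_mono _ (e.functor.map m) hZ
    exact ⟨G', ⟨e.inverse.mapIso j ≪≫ e.unitIso.symm.app X⟩⟩

theorem isLocalic_of_retraction (E : Topos.{w})
    (h : ∀ ⦃F : Topos.{w}⦄ (f : E ⟶ F), hyperconnected f →
      ∃ r : F ⟶ E, Nonempty (f ≫ r ≅ 𝟙 E)) : IsLocalic E := by
  obtain ⟨L, hL, F, f, hf, ⟨e⟩⟩ := exists_hyperconnected E
  obtain ⟨r, ⟨i⟩⟩ := h f hf
  have := hf.full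
  have := hf.faithful
  -- The inverse image of `f ≫ r` is `r^*` followed by `f^*`, so each `Y` is isomorphic to `f^* (r^*
  -- Y)`.
  have : (GeomMorph.inverse f).EssSurj := ⟨fun Y => ⟨(GeomMorph.inverse r).obj Y,
    ⟨{ hom := (GeomMorph.Hom.nat i.hom).app Y
       inv := (GeomMorph.Hom.nat i.inv).app Y
       hom_inv_id := NatTrans.congr_app (congrArg GeomMorph.Hom.nat i.hom_inv_id) Y
       inv_hom_id := NatTrans.congr_app (congrArg GeomMorph.Hom.nat i.inv_hom_id) Y }⟩⟩⟩
  have : (GeomMorph.inverse f).IsEquivalence := { }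
  exact ⟨L, hL, ⟨(GeomMorph.inverse f).asEquivalence.symm.trans e⟩⟩

theorem isRightKanInjective_iff_isLocalic (E : Topos.{w}) :
    IsRightKanInjective hyperconnected E ↔ IsLocalic E := by
  refine ⟨fun h => isLocalic_of_retraction E fun F f hf => ?_,
    fun h a b f hf x => exists_isKan_right hf h x⟩
  obtain ⟨t, -, _⟩ := h f hf (𝟙 E)
  exact ⟨t.extension, ⟨asIso t.counit⟩⟩

theorem isLeftKanInjective_iff_isLocalic (E : Topos.{w}) :
    IsLeftKanInjective hyperconnected E ↔ IsLocalic E := by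
  refine ⟨fun h => isLocalic_of_retraction E fun F f hf => ?_,
    fun h a b f hf x => exists_isKan_left hf h x⟩
  obtain ⟨t, -, _⟩ := h f hf (𝟙 E)
  exact ⟨t.extension, ⟨(asIso t.unit).symm⟩⟩

theorem rInj_hyperconnected : RInj hyperconnected.{w} = LocTopoi.{w} := by
  refine LocallyFullSub.ext (funext fun X => propext (isRightKanInjective_iff_isLocalic X))
    (funext fun X => funext fun Y => funext fun h => propext ?_)
  change _ ∧ _ ∧ _ ↔ _ ∧ _
  rw [isRightKanInjective_iff_isLocalic, isRightKanInjective_iff_isLocalic]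
  exact ⟨fun k => ⟨k.1, k.2.1⟩, fun k => ⟨k.1, k.2, k.1.preservesRightKan h⟩⟩

theorem lInj_hyperconnected : LInj hyperconnected.{w} = LocTopoi.{w} := by
  refine LocallyFullSub.ext (funext fun X => propext (isLeftKanInjective_iff_isLocalic X))
    (funext fun X => funext fun Y => funext fun h => propext ?_)
  change _ ∧ _ ∧ _ ↔ _ ∧ _
  rw [isLeftKanInjective_iff_isLocalic, isLeftKanInjective_iff_isLocalic]
  exact ⟨fun k => ⟨k.1, k.2.1⟩, fun k => ⟨k.1, k.2, k.1.preservesLeftKan h⟩⟩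

end KanInj

theorem mainTheorem10 :
    (∀ L : KanInj.Topos.{w},
      KanInj.IsLocalic L ↔ KanInj.IsRightKanInjective KanInj.hyperconnected L) ∧
    KanInj.LInj KanInj.hyperconnected.{w} = KanInj.RInj KanInj.hyperconnected.{w} ∧
    KanInj.RInj KanInj.hyperconnected.{w} = KanInj.LocTopoi.{w} :=
  ⟨fun L => (KanInj.isRightKanInjective_iff_isLocalic L).symm,
    KanInj.lInj_hyperconnected.trans KanInj.rInj_hyperconnected.symm, KanInj.rInj_hyperconnected⟩
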